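/- For $\alpha\in(0,2)$, $n\in\mathbb{N}=\{1,2,3,\dots\}$ and $\lambda\in(0,1]$ let $$R(\alpha,n,\lambda):=\frac{\alpha\lambda^{\alpha}\sin(\alpha\pi)}{\pi}\int_0^1 t^{\alpha-1}(1-t)^{\alpha n}\left\{\frac{1}{|t^{\alpha}-\lambda^{\alpha}e^{-i\alpha\pi}|^2}+\frac{\lambda^{\alpha n}}{|e^{-i\alpha\pi}-(\lambda t)^{\alpha}|^2}\right\}dt .$$ Then for all $n\in\mathbb{N}$ and $\lambda\in(0,1]$: $$0<R(\alpha,n,\lambda)<1-\alpha\ (<1)\quad\text{for }\alpha\in(0,1),$$ $$(-1<)\ 1-\alpha<R(\alpha,n,\lambda)<0\quad\text{for }\alpha\in(1,2).$$ In particular, $|R(\alpha,n,\lambda)|<1$ for all $\alpha\in(0,2)$, $n\in\mathbb{N}$ and $\lambda\in(0,1]$ (at $\alpha=1$, $R(1,n,\lambda)=0$), so $R$ is uniformly bounded. -/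

import Mathlib

/-- The error term `R(α, n, lam)` in the generalised binomial identity: `(α lam^α sin(απ) / π)` times
`∫₀¹ t^(α-1) (1-t)^(αn) (1/|t^α - lam^α e^(-iαπ)|² + lam^(αn)/|e^(-iαπ) - (lam t)^α|²) dt`.
All powers are real powers of nonnegative reals. -/
noncomputable def neoError (α : ℝ) (n : ℕ) (lam : ℝ) : ℝ :=
  α * lam ^ α * Real.sin (α * Real.pi) / Real.pi *
    ∫ t in (0 : ℝ)..1, t ^ (α - 1) * (1 - t) ^ (α * (n : ℝ)) *
      (1 / ‖((t ^ α : ℝ) : ℂ) -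
            ((lam ^ α : ℝ) : ℂ) * Complex.exp (-(Complex.I * (α : ℂ) * (Real.pi : ℂ)))‖ ^ 2
        + lam ^ (α * (n : ℝ)) /
          ‖Complex.exp (-(Complex.I * (α : ℂ) * (Real.pi : ℂ))) -
            (((lam * t) ^ α : ℝ) : ℂ)‖ ^ 2)

open Set Real

/-! The sign of R is that of sin(απ), since the integrand is positive on (0,1). For the size,
replace both weights (1-t)^(αn) and lam^(αn) by 1: this strictly enlarges the integral, and the
enlarged one is explicit. With u = t^α each fraction integrates to an arctan, and
`arctan_sub_cos_div_sin_add_inv` makes the total (π - θ)/sin θ, independent of lam. Taking θ = απ or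
θ = 2π - απ, whichever lies in (0,π), turns this into the bound 1 - α. -/

lemma arctan_sub_cos_div_sin_add_inv {θ a : ℝ} (h0 : 0 < θ) (h1 : θ < π) (ha : 0 < a)
    (ha1 : a ≤ 1) :
    arctan ((1 / a - cos θ) / sin θ) + arctan ((a - cos θ) / sin θ) = θ := by
  have hS : 0 < sin θ := sin_pos_of_pos_of_lt_pi h0 h1
  have hd : ∀ x : ℝ, 0 < x → HasDerivAt
      (fun x => arctan ((x⁻¹ - cos θ) / sin θ) + arctan ((x - cos θ) / sin θ)) 0 x := by
    intro x hx
    have e1 := (((hasDerivAt_inv hx.ne').sub_const (cos θ)).div_const (sin θ)).arctan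
    have e2 := (((hasDerivAt_id' x).sub_const (cos θ)).div_const (sin θ)).arctan
    refine (e1.add e2).congr_deriv ?_
    have p1 : 0 < (1 - x * cos θ) ^ 2 + (x * sin θ) ^ 2 := by positivity
    have p2 : 0 < (x - cos θ) ^ 2 + sin θ ^ 2 := by positivity
    have q1 : 1 / (1 + ((x⁻¹ - cos θ) / sin θ) ^ 2) * (-(x ^ 2)⁻¹ / sin θ)
        = - sin θ / ((1 - x * cos θ) ^ 2 + (x * sin θ) ^ 2) := by
      have : 1 + ((x⁻¹ - cos θ) / sin θ) ^ 2 =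
          ((1 - x * cos θ) ^ 2 + (x * sin θ) ^ 2) / (x * sin θ) ^ 2 := by
        field_simp; ring
      rw [this]; field_simp
    have q2 : 1 / (1 + ((x - cos θ) / sin θ) ^ 2) * (1 / sin θ)
        = sin θ / ((x - cos θ) ^ 2 + sin θ ^ 2) := by
      have : 1 + ((x - cos θ) / sin θ) ^ 2 = ((x - cos θ) ^ 2 + sin θ ^ 2) / sin θ ^ 2 := by
        field_simp; ring
      rw [this]; field_simp
    -- Both sides equal 1 - 2x cos θ + x², so the two derivatives cancel.
    have q3 : (1 - x * cos θ) ^ 2 + (x * sin θ) ^ 2 = (x - cos θ) ^ 2 + sin θ ^ 2 := by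
      linear_combination (x ^ 2 - 1) * sin_sq_add_cos_sq θ
    rw [q1, q2, q3]; ring
  -- The sum is constant on [a, 1]; at x = 1 both arctans equal θ/2.
  have hc := constant_of_has_deriv_right_zero (a := a) (b := 1)
    (fun x hx => (hd x (ha.trans_le hx.1)).continuousAt.continuousWithinAt)
    (fun x hx => (hd x (ha.trans_le hx.1)).hasDerivWithinAt) 1 ⟨ha1, le_rfl⟩
  have hhalf : (1 - cos θ) / sin θ = tan (θ / 2) := by
    have hs2 : 0 < sin (θ / 2) := sin_pos_of_pos_of_lt_pi (by linarith) (by linarith)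
    have hc2 : 0 < cos (θ / 2) := cos_pos_of_mem_Ioo ⟨by linarith, by linarith⟩
    have e1 : sin θ = 2 * sin (θ / 2) * cos (θ / 2) := by rw [← sin_two_mul]; congr 1; ring
    have e2 : cos θ = 1 - 2 * sin (θ / 2) ^ 2 := by
      have := cos_two_mul (θ / 2)
      rw [show 2 * (θ / 2) = θ by ring] at this
      linear_combination this + 2 * sin_sq_add_cos_sq (θ / 2)
    rw [tan_eq_sin_div_cos, e1, e2]; field_simp; ring
  simp only [inv_one, hhalf] at hc
  rw [arctan_tan (by linarith) (by linarith)] at hc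
  rw [one_div]
  linarith

lemma arctan_neg_cos_div_sin {θ : ℝ} (h0 : 0 < θ) (h1 : θ < π) :
    arctan ((0 - cos θ) / sin θ) = θ - π / 2 := by
  have : (0 - cos θ) / sin θ = tan (θ - π / 2) := by
    rw [tan_eq_sin_div_cos, sin_sub_pi_div_two, cos_sub_pi_div_two, zero_sub]
  rw [this, arctan_tan (by linarith) (by linarith)]

lemma normSq_sub_mul_exp (x y φ : ℝ) :
    ‖(x : ℂ) - (y : ℂ) * Complex.exp (-(Complex.I * (φ : ℂ)))‖ ^ 2
      = (x - y * cos φ) ^ 2 + (y * sin φ) ^ 2 := by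
  have : -(Complex.I * (φ : ℂ)) = ((-φ : ℝ) : ℂ) * Complex.I := by push_cast; ring
  rw [← Complex.normSq_eq_norm_sq, Complex.normSq_apply, this]
  simp only [Complex.sub_re, Complex.sub_im, Complex.re_ofReal_mul, Complex.im_ofReal_mul,
    Complex.exp_ofReal_mul_I_re, Complex.exp_ofReal_mul_I_im, Complex.ofReal_re,
    Complex.ofReal_im, cos_neg, sin_neg]
  ring

/-- The integrand of `neoError`, with the angle `θ`, the weight exponent `m`, the factor `b`
and `a = lam ^ α` as free parameters. -/
noncomputable def neoIntegrand (α θ m a b t : ℝ) : ℝ :=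
  t ^ (α - 1) * ((1 - t) ^ m * (1 / ((t ^ α - a * cos θ) ^ 2 + (a * sin θ) ^ 2)
    + b / ((a * t ^ α - cos θ) ^ 2 + sin θ ^ 2)))

lemma intervalIntegrable_neoIntegrand {α θ m a : ℝ} (b : ℝ) (hα : 0 < α) (hS : sin θ ≠ 0)
    (hm : 0 ≤ m) (ha : 0 < a) :
    IntervalIntegrable (neoIntegrand α θ m a b) MeasureTheory.volume 0 1 := by
  refine (intervalIntegral.intervalIntegrable_rpow' (by linarith)).mul_continuousOn
    (Continuous.continuousOn ?_)
  have c1 : Continuous fun t : ℝ => t ^ α := continuous_rpow_const hα.le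
  have c2 : Continuous fun t : ℝ => (1 - t) ^ m :=
    (continuous_rpow_const hm).comp (continuous_const.sub continuous_id)
  refine c2.mul ((continuous_const.div (by fun_prop) fun t => ?_).add
    (continuous_const.div (by fun_prop) fun t => ?_))
  · positivity
  · positivity

lemma hasDerivAt_arctan_antideriv {α θ a t : ℝ} (hS : 0 < sin θ) (ha : 0 < a) (ht : 0 < t) :
    HasDerivAt (fun t : ℝ => (arctan ((t ^ α / a - cos θ) / sin θ)
        + arctan ((a * t ^ α - cos θ) / sin θ)) / sin θ)
      (α * a * neoIntegrand α θ 0 a 1 t) t := by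
  have hu : HasDerivAt (fun t : ℝ => t ^ α) (α * t ^ (α - 1)) t :=
    hasDerivAt_rpow_const (Or.inl ht.ne')
  have e1 := (((hu.div_const a).sub_const (cos θ)).div_const (sin θ)).arctan
  have e2 := (((hu.const_mul a).sub_const (cos θ)).div_const (sin θ)).arctan
  refine ((e1.add e2).div_const (sin θ)).congr_deriv ?_
  rw [neoIntegrand, rpow_zero]
  generalize t ^ α = u
  generalize t ^ (α - 1) = v
  have p1 : 0 < (u - a * cos θ) ^ 2 + (a * sin θ) ^ 2 := by positivity
  have p2 : 0 < (a * u - cos θ) ^ 2 + sin θ ^ 2 := by positivity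
  have q1 : 1 + ((u / a - cos θ) / sin θ) ^ 2
      = ((u - a * cos θ) ^ 2 + (a * sin θ) ^ 2) / (a * sin θ) ^ 2 := by
    field_simp; ring
  have q2 : 1 + ((a * u - cos θ) / sin θ) ^ 2
      = ((a * u - cos θ) ^ 2 + sin θ ^ 2) / sin θ ^ 2 := by
    field_simp; ring
  rw [q1, q2]
  generalize (u - a * cos θ) ^ 2 + (a * sin θ) ^ 2 = D at *
  generalize (a * u - cos θ) ^ 2 + sin θ ^ 2 = E at *
  field_simp

/-- The arctans sum to θ at t = 1 and to 2(θ - π/2) at t = 0. Differentiability is used only on the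
open interval, as t^α may have no derivative at 0. -/
lemma integral_neoIntegrand_unweighted {α θ a : ℝ} (hα : 0 < α) (h0 : 0 < θ) (h1 : θ < π)
    (ha : 0 < a) (ha1 : a ≤ 1) :
    α * a * ∫ t in (0 : ℝ)..1, neoIntegrand α θ 0 a 1 t = (π - θ) / sin θ := by
  have hS : 0 < sin θ := sin_pos_of_pos_of_lt_pi h0 h1
  have c1 : Continuous fun t : ℝ => t ^ α := continuous_rpow_const hα.le
  rw [← intervalIntegral.integral_const_mul,
    intervalIntegral.integral_eq_sub_of_hasDerivAt_of_le zero_le_one (by fun_prop)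
      (fun t ht => hasDerivAt_arctan_antideriv hS ha ht.1)
      ((intervalIntegrable_neoIntegrand 1 hα hS.ne' le_rfl ha).const_mul (α * a))]
  rw [one_rpow, zero_rpow hα.ne', zero_div, mul_zero, mul_one,
    arctan_sub_cos_div_sin_add_inv h0 h1 ha ha1, arctan_neg_cos_div_sin h0 h1]
  ring

lemma integral_neoIntegrand_bounds {α θ m a b : ℝ} (hα : 0 < α) (h0 : 0 < θ) (h1 : θ < π)
    (ha : 0 < a) (ha1 : a ≤ 1) (hm : 0 < m) (hb : 0 < b) (hb1 : b ≤ 1) :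
    0 < α * a * ∫ t in (0 : ℝ)..1, neoIntegrand α θ m a b t ∧
    α * a * ∫ t in (0 : ℝ)..1, neoIntegrand α θ m a b t < (π - θ) / sin θ := by
  have hS : 0 < sin θ := sin_pos_of_pos_of_lt_pi h0 h1
  have i1 := intervalIntegrable_neoIntegrand b hα hS.ne' hm.le ha
  have i2 := intervalIntegrable_neoIntegrand 1 hα hS.ne' le_rfl ha
  constructor
  · refine mul_pos (mul_pos hα ha)
      (intervalIntegral.intervalIntegral_pos_of_pos_on i1 (fun t ht => ?_) zero_lt_one)
    have := ht.1
    have : 0 < 1 - t := sub_pos.2 ht.2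
    unfold neoIntegrand
    positivity
  · rw [← integral_neoIntegrand_unweighted hα h0 h1 ha ha1]
    refine mul_lt_mul_of_pos_left (sub_pos.1 ?_) (mul_pos hα ha)
    rw [← intervalIntegral.integral_sub i2 i1]
    refine intervalIntegral.intervalIntegral_pos_of_pos_on (i2.sub i1) (fun t ht => ?_)
      zero_lt_one
    refine sub_pos.2 ?_
    have ht0 := ht.1
    -- Strictness comes from this weight alone, since b = 1 is allowed.
    have hw : (1 - t) ^ m < 1 :=
      rpow_lt_one (sub_pos.2 ht.2).le (by linarith) hm
    unfold neoIntegrand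
    rw [rpow_zero]
    refine mul_lt_mul_of_pos_left ?_ (rpow_pos_of_pos ht0 _)
    refine mul_lt_mul hw (by gcongr) ?_ zero_le_one
    positivity

/-- The moduli involve the angle only through its cosine and squared sine, so απ may be reflected to
2π - απ. -/
lemma neoError_eq {α lam : ℝ} (n : ℕ) (hlam : 0 < lam) {θ : ℝ} (hc : cos (α * π) = cos θ) :
    neoError α n lam = sin (α * π) / π * (α * lam ^ α *
      ∫ t in (0 : ℝ)..1, neoIntegrand α θ (α * n) (lam ^ α) (lam ^ (α * (n : ℝ))) t) := by
  have hs : sin (α * π) ^ 2 = sin θ ^ 2 := by rw [sin_sq, sin_sq, hc]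
  have key : ∀ t ∈ uIcc (0 : ℝ) 1, t ^ (α - 1) * (1 - t) ^ (α * (n : ℝ)) *
      (1 / ‖((t ^ α : ℝ) : ℂ) -
            ((lam ^ α : ℝ) : ℂ) * Complex.exp (-(Complex.I * (α : ℂ) * (Real.pi : ℂ)))‖ ^ 2
        + lam ^ (α * (n : ℝ)) /
          ‖Complex.exp (-(Complex.I * (α : ℂ) * (Real.pi : ℂ))) -
            (((lam * t) ^ α : ℝ) : ℂ)‖ ^ 2)
      = neoIntegrand α θ (α * n) (lam ^ α) (lam ^ (α * (n : ℝ))) t := by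
    intro t ht
    rw [uIcc_of_le zero_le_one] at ht
    have e : Complex.I * (α : ℂ) * (π : ℂ) = Complex.I * ((α * π : ℝ) : ℂ) := by
      push_cast; ring
    have h2 := normSq_sub_mul_exp ((lam * t) ^ α) 1 (α * π)
    rw [Complex.ofReal_one, one_mul, one_mul, one_mul] at h2
    rw [e, normSq_sub_mul_exp, norm_sub_rev (Complex.exp _), h2, neoIntegrand, hc, mul_pow, hs,
      mul_rpow hlam.le ht.1, mul_pow]
    ring
  rw [neoError, intervalIntegral.integral_congr key]
  ring

lemma neoError_bounds_of_lt_one {α lam : ℝ} {n : ℕ} (hn : 1 ≤ n) (hlam0 : 0 < lam)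
    (hlam1 : lam ≤ 1) (h0 : 0 < α) (h1 : α < 1) :
    0 < neoError α n lam ∧ neoError α n lam < 1 - α := by
  have hθ0 : 0 < α * π := by positivity
  have hθ1 : α * π < π := by nlinarith [pi_pos]
  have hm : 0 < α * (n : ℝ) := mul_pos h0 (by exact_mod_cast hn)
  have hS : 0 < sin (α * π) := sin_pos_of_pos_of_lt_pi hθ0 hθ1
  obtain ⟨hl, hu⟩ := integral_neoIntegrand_bounds h0 hθ0 hθ1 (rpow_pos_of_pos hlam0 α)
    (rpow_le_one hlam0.le hlam1 h0.le) hm (rpow_pos_of_pos hlam0 (α * n))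
    (rpow_le_one hlam0.le hlam1 hm.le)
  have hk : 0 < sin (α * π) / π := by positivity
  rw [neoError_eq n hlam0 rfl]
  refine ⟨mul_pos hk hl, (mul_lt_mul_of_pos_left hu hk).trans_eq ?_⟩
  field_simp

lemma neoError_bounds_of_one_lt {α lam : ℝ} {n : ℕ} (hn : 1 ≤ n) (hlam0 : 0 < lam)
    (hlam1 : lam ≤ 1) (h1 : 1 < α) (h2 : α < 2) :
    1 - α < neoError α n lam ∧ neoError α n lam < 0 := by
  have h0 : 0 < α := by linarith
  have hθ0 : 0 < 2 * π - α * π := by nlinarith [pi_pos]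
  have hθ1 : 2 * π - α * π < π := by nlinarith [pi_pos]
  have hm : 0 < α * (n : ℝ) := mul_pos h0 (by exact_mod_cast hn)
  have hS : 0 < sin (2 * π - α * π) := sin_pos_of_pos_of_lt_pi hθ0 hθ1
  have hs : sin (α * π) = -sin (2 * π - α * π) := by rw [sin_two_pi_sub, neg_neg]
  obtain ⟨hl, hu⟩ := integral_neoIntegrand_bounds h0 hθ0 hθ1 (rpow_pos_of_pos hlam0 α)
    (rpow_le_one hlam0.le hlam1 h0.le) hm (rpow_pos_of_pos hlam0 (α * n))
    (rpow_le_one hlam0.le hlam1 hm.le)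
  -- The negative prefactor reverses both bounds; here π - θ = (α - 1)π.
  have hk : sin (α * π) / π < 0 := div_neg_of_neg_of_pos (by linarith) pi_pos
  rw [neoError_eq n hlam0 (cos_two_pi_sub (α * π)).symm]
  refine ⟨Eq.trans_lt ?_ (mul_lt_mul_of_neg_left hu hk), mul_neg_of_neg_of_pos hk hl⟩
  rw [hs]
  generalize sin (2 * π - α * π) = s at hS
  field_simp
  ring

lemma neoError_one (n : ℕ) (lam : ℝ) : neoError 1 n lam = 0 := by
  simp [neoError]

theorem proposition2p5 (n : ℕ) (hn : 1 ≤ n) (lam : ℝ) (hlam0 : 0 < lam) (hlam1 : lam ≤ 1) :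
    (∀ α : ℝ, 0 < α → α < 1 → 0 < neoError α n lam ∧ neoError α n lam < 1 - α) ∧
    (∀ α : ℝ, 1 < α → α < 2 → 1 - α < neoError α n lam ∧ neoError α n lam < 0) ∧
    (∀ α : ℝ, 0 < α → α < 2 → |neoError α n lam| < 1) := by
  refine ⟨fun α h0 h1 => neoError_bounds_of_lt_one hn hlam0 hlam1 h0 h1,
    fun α h1 h2 => neoError_bounds_of_one_lt hn hlam0 hlam1 h1 h2, fun α h0 h2 => abs_lt.2 ?_⟩
  rcases lt_trichotomy α 1 with h | rfl | h
  · obtain ⟨hl, hu⟩ := neoError_bounds_of_lt_one hn hlam0 hlam1 h0 h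
    constructor <;> linarith
  · rw [neoError_one]; norm_num
  · obtain ⟨hl, hu⟩ := neoError_bounds_of_one_lt hn hlam0 hlam1 h h2
    constructor <;> linarith
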